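/- Let $\mathcal X,\mathcal Y$ be measurable spaces, let $\Theta$ be a standard Borel parameter space (for instance a compact subset of $\mathbb R^m$), let $\lambda$ be a fixed hyperparameter, let $\mathcal D$ be a probability distribution on $\mathcal X\times\mathcal Y$, and let $s\ge 1$. Let the loss $\ell(\theta;x,y,\lambda)$ be measurable in $(\theta,x,y)$ with values in $[a,b]$, $a\le b$. For a data set $S=((x_i,y_i))_{i=1}^s$ put $$\hat R(\theta;S,\lambda)=\frac1s\sum_{i=1}^s\ell(\theta;x_i,y_i,\lambda),\qquad R(\theta;\mathcal D,\lambda)=\mathbb E_{(x,y)\sim\mathcal D}[\ell(\theta;x,y,\lambda)].$$ A data-dependent prior is a Markov kernel $S\mapsto P_S$ from $(\mathcal X\times\mathcal Y)^s$ to $\Theta$. It is $(\epsilon,\delta)$-differentially private if $P_{S_1}(I)\le e^{\epsilon}P_{S_2}(I)+\delta$ for all measurable $I\subseteq\Theta$ and all $S_1,S_2$ that differ in at most one element. For $c_0>0$ write $$\beta(\epsilon,\delta,s)=\exp\{-s\epsilon^2\}+c_0\,s\sqrt{\delta/\epsilon}.$$ **Theorem.** There are absolute constants $c_0,c_1,c_2>0$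 such that for all data as above, all $\epsilon\in(0,\tfrac12]$, $\delta\in(0,\epsilon)$, $\Delta\in(0,1)$ and every $(\epsilon,\delta)$-differentially private prior $P_S$ the following two statements hold. 1. If $\beta(\epsilon,\delta,s)<1$, then with probability at least $1-\Delta$ over $S\sim\mathcal D^s$, simultaneously for all probability distributions $Q$ on $\Theta$, $$\mathbb E_Q[R(\theta;\mathcal D,\lambda)]\le\mathbb E_Q[\hat R(\theta;S,\lambda)]+\left\{\frac{(b-a)^2}{2s-1}\left(\mathrm{KL}(Q\|P_S)+\log\frac{4s\exp\left\{s\left(c_1\epsilon^2+c_2\sqrt{\delta/\epsilon}\right)\right\}+\beta(\epsilon,\delta,s)\exp\{2s\}}{\Delta}\right)\right\}^{1/2}.$$ 2. If $\beta(\epsilon,\delta,s)<\min\left(1,\;s\exp\left\{s\left(c_1\epsilon^2+c_2\sqrt{\delta/\epsilon}-2\right)\right\}\right)$, then with probability at least $1-\Delta$ over $S\sim\mathcal D^s$, simultaneously for all probability distributions $Q$ on $\Theta$, $$\mathbb E_Q[R(\theta;\mathcal D,\lambda)]\le\mathbb E_Q[\hat R(\theta;S,\lambda)]+(b-a)\left\{\frac{1}{2s-1}\left(\mathrm{KL}(Q\|P_S)+\log\frac{5s}{\Delta}\right)+c_1\epsilon^2+c_2\sqrt{\delta/\epsilon}\right\}^{1/2}.$$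 (If $\mathrm{KL}(Q\|P_S)=\infty$, the bounds assert nothing.) -/

import Mathlib

open MeasureTheory ProbabilityTheory

noncomputable section

namespace DPPacBayes

/-- The statement `E` holds with probability at least `p` under `μ`. (A measurable event of
probability at least `p` on which `E` holds is required, so that no measurability of `E` itself
has to be assumed.) -/
def HoldsWithProbAtLeast {Ω : Type*} [MeasurableSpace Ω] (μ : Measure Ω) (p : ℝ)
    (E : Ω → Prop) : Prop :=
  ∃ G : Set Ω, MeasurableSet G ∧ (∀ ω ∈ G, E ω) ∧ ENNReal.ofReal p ≤ μ G

/-- Two data sets of size `s` are adjacent if they differ in at most one element. -/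
def Adjacent {Z : Type*} {s : ℕ} (S₁ S₂ : Fin s → Z) : Prop :=
  ∃ i : Fin s, ∀ j : Fin s, j ≠ i → S₁ j = S₂ j

/-- `(ε, δ)`-differential privacy of a randomized algorithm, given as the kernel that sends a
data set to the law of the output. -/
def IsDP {Z U : Type*} [MeasurableSpace Z] [MeasurableSpace U] {s : ℕ}
    (A : Kernel (Fin s → Z) U) (ε δ : ℝ) : Prop :=
  ∀ S₁ S₂ : Fin s → Z, Adjacent S₁ S₂ → ∀ I : Set U, MeasurableSet I →
    A S₁ I ≤ ENNReal.ofReal (Real.exp ε) * A S₂ I + ENNReal.ofReal δ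

/-- The empirical risk `R̂(θ; S, lam)`: the average loss over the data set `S`. -/
def empRisk {Θ 𝒳 𝒴 Λ : Type*} (ℓ : Θ → 𝒳 → 𝒴 → Λ → ℝ) {s : ℕ} (θ : Θ)
    (S : Fin s → 𝒳 × 𝒴) (lam : Λ) : ℝ :=
  (1 / (s : ℝ)) * ∑ i, ℓ θ (S i).1 (S i).2 lam

/-- The expected risk `R(θ; D, lam)`: the mean loss under the data-generating distribution. -/
def risk {Θ 𝒳 𝒴 Λ : Type*} [MeasurableSpace 𝒳] [MeasurableSpace 𝒴]
    (ℓ : Θ → 𝒳 → 𝒴 → Λ → ℝ) (θ : Θ) (D : Measure (𝒳 × 𝒴)) (lam : Λ) : ℝ :=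
  ∫ z, ℓ θ z.1 z.2 lam ∂D

/-- `β(ε, δ, s) = exp (-s ε²) + O(s √(δ/ε))`, where `c₀` is the constant of the `O`-term. -/
def betaFn (c₀ ε δ : ℝ) (s : ℕ) : ℝ :=
  Real.exp (-(s : ℝ) * ε ^ 2) + c₀ * ((s : ℝ) * √(δ / ε))

end DPPacBayes

end

namespace DPPacBayes

open scoped ENNReal

/-! Write `L` for the loss rescaled to [0, 1]. Everything rests on the exponential moment of F = ∑ᵢ
2(E L − L(Sᵢ)) under the joint law of the sample and the prior. Privacy allows the kernel's i-th
data point to be replaced by a fresh one, at the price of a factor exp ε and an additive δ-term;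
exchanging the two i.i.d. points then makes Sᵢ independent of the output. Peeling off the
coordinates one by one (`IsDP.lintegral_mul_le`, `IsDP.lintegral_prod_le`) and applying Hoeffding's
lemma to each factor gives at most exp(s(ε + 1/2)) + sδ exp(2s). Markov's inequality and
Donsker–Varadhan turn this into a bound on E_Q F, uniform in Q. It is linear in the gap, and the gap
is at most b − a, so the square-root form follows. The moment already lies below β exp(2s), so the
other summand in the logarithm is slack. -/

/-! ### Decoupling the sample from a private output. -/

/-- A differentially private kernel changes integrals of bounded functions in the same way as it
changes probabilities. -/
theorem IsDP.lintegral_le {Z U : Type*} [MeasurableSpace Z] [MeasurableSpace U] {s : ℕ}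
    {A : Kernel (Fin s → Z) U} {ε δ : ℝ} (hA : IsDP A ε δ) {S₁ S₂ : Fin s → Z}
    (hS : Adjacent S₁ S₂) {h : U → ℝ≥0∞} (hh : Measurable h) {M : ℝ≥0∞} (hM : M ≠ ∞)
    (hhM : ∀ u, h u ≤ M) :
    ∫⁻ u, h u ∂A S₁ ≤ ENNReal.ofReal (Real.exp ε) * ∫⁻ u, h u ∂A S₂ + ENNReal.ofReal δ * M := by
  -- Layer cake: privacy is applied to each superlevel set, and δ is paid only at levels t < M,
  -- since higher sets are empty.
  have hlayer (μ : Measure U) :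
      ∫⁻ u, h u ∂μ = ∫⁻ t in Set.Ioi (0 : ℝ), μ {u | t < (h u).toReal} := by
    rw [← lintegral_eq_lintegral_meas_lt μ (.of_forall fun _ => ENNReal.toReal_nonneg)
      hh.ennreal_toReal.aemeasurable]
    exact lintegral_congr fun u =>
      (ENNReal.ofReal_toReal (ne_top_of_le_ne_top hM (hhM u))).symm
  have hind : ∫⁻ t in Set.Ioi (0 : ℝ),
      (Set.Iio M.toReal).indicator (fun _ => ENNReal.ofReal δ) t = ENNReal.ofReal δ * M := by
    rw [lintegral_indicator measurableSet_Iio, Measure.restrict_restrict measurableSet_Iio,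
      setLIntegral_const, Set.Iio_inter_Ioi, Real.volume_Ioo, sub_zero, ENNReal.ofReal_toReal hM]
  rw [hlayer (A S₁), hlayer (A S₂), ← hind, ← lintegral_const_mul' _ _ ENNReal.ofReal_ne_top,
    ← lintegral_add_right _ (measurable_const.indicator measurableSet_Iio)]
  refine lintegral_mono fun t => ?_
  by_cases ht : t < M.toReal
  · rw [Set.indicator_of_mem (Set.mem_Iio.2 ht)]
    exact hA S₁ S₂ hS _ (measurableSet_lt measurable_const hh.ennreal_toReal)
  · have : {u | t < (h u).toReal} = ∅ := Set.eq_empty_of_forall_notMem fun u hu =>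
      ht (lt_of_lt_of_le hu (ENNReal.toReal_mono hM (hhM u)))
    simp [this]

/-- Averaging one coordinate of a product measure afresh does not change an integral. -/
theorem lintegral_pi_update {ι Z : Type*} [Fintype ι] [DecidableEq ι] [MeasurableSpace Z]
    (D : Measure Z) [IsProbabilityMeasure D] (i : ι) {f : (ι → Z) → ℝ≥0∞} (hf : Measurable f) :
    ∫⁻ S, ∫⁻ z, f (Function.update S i z) ∂D ∂Measure.pi (fun _ : ι => D)
      = ∫⁻ S, f S ∂Measure.pi (fun _ : ι => D) := by
  have hmeas : Measurable fun S : ι → Z => ∫⁻ z, f (Function.update S i z) ∂D :=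
    Measurable.lintegral_prod_right (hf.comp measurable_update')
  refine lintegral_eq_of_lmarginal_eq {i} hmeas hf ?_
  simp [lmarginal_singleton]

/-- Decoupling one coordinate of the sample from the output of a differentially private kernel. -/
theorem IsDP.lintegral_mul_le {Z U : Type*} [MeasurableSpace Z] [MeasurableSpace U] {s : ℕ}
    {A : Kernel (Fin s → Z) U} [IsMarkovKernel A] {ε δ : ℝ} (hA : IsDP A ε δ)
    (D : Measure Z) [IsProbabilityMeasure D] (i : Fin s)
    {g : U → Z → ℝ≥0∞} (hg : Measurable fun p : U × Z => g p.1 p.2)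
    {h : U → (Fin s → Z) → ℝ≥0∞} (hh : Measurable fun p : U × (Fin s → Z) => h p.1 p.2)
    (hi : ∀ u S z, h u (Function.update S i z) = h u S)
    {M : ℝ≥0∞} (hM : M ≠ ∞) (hgh : ∀ u z S, g u z * h u S ≤ M) {m : ℝ≥0∞}
    (hmtop : m ≠ ∞) (hm : ∀ u, ∫⁻ z, g u z ∂D ≤ m) :
    ∫⁻ S, ∫⁻ u, g u (S i) * h u S ∂A S ∂Measure.pi (fun _ => D)
      ≤ ENNReal.ofReal (Real.exp ε) * m * ∫⁻ S, ∫⁻ u, h u S ∂A S ∂Measure.pi (fun _ => D)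
        + ENNReal.ofReal δ * M := by
  have hupd : Measurable fun p : (Fin s → Z) × Z => Function.update p.1 i p.2 :=
    measurable_update'
  have hgS : Measurable fun p : U × (Fin s → Z) => g p.1 (p.2 i) := by
    exact hg.comp (by fun_prop : Measurable fun p : U × (Fin s → Z) => (p.1, p.2 i))
  -- Sᵢ and z are i.i.d. and h ignores coordinate i, so they may trade places. Formally: resample Sᵢ
  -- as w, swap w and z by Fubini, then undo the resampling.
  have hswap : ∫⁻ S, ∫⁻ z, ∫⁻ u, g u (S i) * h u S ∂A (Function.update S i z) ∂D
        ∂Measure.pi (fun _ => D)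
      = ∫⁻ S, ∫⁻ u, (∫⁻ z, g u z ∂D) * h u S ∂A S ∂Measure.pi (fun _ => D) := by
    have hker : Measurable fun q : ((Fin s → Z) × Z) × Z =>
        ∫⁻ u, g u q.2 * h u q.1.1 ∂A (Function.update q.1.1 i q.1.2) := by
      have hk := Measurable.lintegral_kernel_prod_right
        (κ := A.comap (fun q : ((Fin s → Z) × Z) × Z => Function.update q.1.1 i q.1.2)
          (hupd.comp measurable_fst))
        (f := fun q u => g u q.2 * h u q.1.1)
        (by
          refine Measurable.mul
            (hg.comp (by fun_prop : Measurable fun p : (((Fin s → Z) × Z) × Z) × U =>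
              (p.2, p.1.2)))
            (hh.comp (by fun_prop : Measurable fun p : (((Fin s → Z) × Z) × Z) × U =>
              (p.2, p.1.1.1))))
      exact hk
    have hker' : Measurable fun q : (Fin s → Z) × Z =>
        ∫⁻ u, g u (q.1 i) * h u q.1 ∂A (Function.update q.1 i q.2) :=
      hker.comp (by fun_prop : Measurable fun q : (Fin s → Z) × Z => ((q.1, q.2), q.1 i))
    have hker'' : Measurable fun q : (Fin s → Z) × Z => ∫⁻ u, g u q.2 * h u q.1 ∂A q.1 := by
      have := hker.comp
        (by fun_prop : Measurable fun q : (Fin s → Z) × Z => ((q.1, q.1 i), q.2))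
      simpa [Function.comp_def] using this
    calc ∫⁻ S, ∫⁻ z, ∫⁻ u, g u (S i) * h u S ∂A (Function.update S i z) ∂D
            ∂Measure.pi (fun _ => D)
        = ∫⁻ S, ∫⁻ w, ∫⁻ z, ∫⁻ u, g u w * h u S ∂A (Function.update S i z) ∂D ∂D
            ∂Measure.pi (fun _ => D) := by
          rw [← lintegral_pi_update D i hker'.lintegral_prod_right']
          simp [hi]
      _ = ∫⁻ S, ∫⁻ z, ∫⁻ w, ∫⁻ u, g u w * h u S ∂A (Function.update S i z) ∂D ∂D
            ∂Measure.pi (fun _ => D) := by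
          refine lintegral_congr fun S => lintegral_lintegral_swap ?_
          exact (hker.comp
            (by fun_prop : Measurable fun p : Z × Z => ((S, p.2), p.1))).aemeasurable
      _ = ∫⁻ S, ∫⁻ w, ∫⁻ u, g u w * h u S ∂A S ∂D ∂Measure.pi (fun _ => D) := by
          rw [← lintegral_pi_update D i hker''.lintegral_prod_right']
          simp [hi]
      _ = ∫⁻ S, ∫⁻ u, (∫⁻ z, g u z ∂D) * h u S ∂A S ∂Measure.pi (fun _ => D) := by
          refine lintegral_congr fun S => ?_
          rw [lintegral_lintegral_swap]
          · refine lintegral_congr fun u => lintegral_mul_const _ ?_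
            exact hg.comp (by fun_prop : Measurable fun z : Z => (u, z))
          · refine Measurable.aemeasurable (Measurable.mul
              (hg.comp (by fun_prop : Measurable fun p : Z × U => (p.2, p.1)))
              (hh.comp (by fun_prop : Measurable fun p : Z × U => (p.2, S))))
  calc ∫⁻ S, ∫⁻ u, g u (S i) * h u S ∂A S ∂Measure.pi (fun _ => D)
      = ∫⁻ S, ∫⁻ _z, ∫⁻ u, g u (S i) * h u S ∂A S ∂D ∂Measure.pi (fun _ => D) := by simp
    _ ≤ ∫⁻ S, ∫⁻ z, (ENNReal.ofReal (Real.exp ε)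
          * ∫⁻ u, g u (S i) * h u S ∂A (Function.update S i z) + ENNReal.ofReal δ * M) ∂D
          ∂Measure.pi (fun _ => D) := by
        refine lintegral_mono fun S => lintegral_mono fun z => ?_
        refine hA.lintegral_le ⟨i, fun j hj => (Function.update_of_ne hj _ _).symm⟩ ?_ hM
          fun u => hgh u _ _
        exact (hgS.mul hh).comp (by fun_prop : Measurable fun u : U => (u, S))
    _ = ENNReal.ofReal (Real.exp ε) * ∫⁻ S, ∫⁻ u, (∫⁻ z, g u z ∂D) * h u S ∂A S
          ∂Measure.pi (fun _ => D) + ENNReal.ofReal δ * M := by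
        simp_rw [lintegral_add_right _ measurable_const,
          lintegral_const_mul' _ _ ENNReal.ofReal_ne_top]
        rw [hswap]
        simp
    _ ≤ _ := by
        rw [mul_assoc]
        gcongr
        rw [← lintegral_const_mul' _ _ hmtop]
        refine lintegral_mono fun S => ?_
        rw [← lintegral_const_mul' _ _ hmtop]
        exact lintegral_mono fun u => by gcongr; exact hm u

/-- The exponential moment bound for a differentially private kernel: a product over the sample of
factors that depend on the output has almost the mean that it would have on an independent
sample. -/
theorem IsDP.lintegral_prod_le {Z U : Type*} [MeasurableSpace Z] [MeasurableSpace U] {s : ℕ}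
    {A : Kernel (Fin s → Z) U} [IsMarkovKernel A] {ε δ : ℝ} (hA : IsDP A ε δ)
    (D : Measure Z) [IsProbabilityMeasure D]
    {g : U → Z → ℝ≥0∞} (hg : Measurable fun p : U × Z => g p.1 p.2)
    {M : ℝ≥0∞} (hM : M ≠ ∞) (hgM : ∀ u z, g u z ≤ M) {m : ℝ≥0∞} (hmtop : m ≠ ∞)
    (hm : ∀ u, ∫⁻ z, g u z ∂D ≤ m) (hmM : ENNReal.ofReal (Real.exp ε) * m ≤ M)
    (T : Finset (Fin s)) :
    ∫⁻ S, ∫⁻ u, ∏ i ∈ T, g u (S i) ∂A S ∂Measure.pi (fun _ => D)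
      ≤ (ENNReal.ofReal (Real.exp ε) * m) ^ T.card
        + T.card * (ENNReal.ofReal δ * M ^ T.card) := by
  induction T using Finset.induction_on with
  | empty => simp
  | insert i T hi ih =>
    have hh : Measurable fun p : U × (Fin s → Z) => ∏ j ∈ T, g p.1 (p.2 j) :=
      Finset.measurable_fun_prod _ fun j _ =>
        hg.comp (by fun_prop : Measurable fun p : U × (Fin s → Z) => (p.1, p.2 j))
    have hprod (u : U) (S : Fin s → Z) : ∏ j ∈ T, g u (S j) ≤ M ^ T.card :=
      Finset.prod_le_pow_card _ _ _ fun j _ => hgM u (S j)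
    simp_rw [Finset.prod_insert hi, Finset.card_insert_of_notMem hi]
    refine (hA.lintegral_mul_le D i hg (h := fun u S => ∏ j ∈ T, g u (S j)) hh
      (fun u S z => Finset.prod_congr rfl fun j hj => ?_)
      (M := M ^ (T.card + 1)) (ENNReal.pow_ne_top hM)
      (fun u z S => ?_) hmtop hm).trans ?_
    · rw [Function.update_of_ne (by rintro rfl; exact hi hj)]
    · rw [pow_succ']
      exact mul_le_mul' (hgM u z) (hprod u S)
    · set c := ENNReal.ofReal (Real.exp ε) * m
      calc c * ∫⁻ S, ∫⁻ u, ∏ j ∈ T, g u (S j) ∂A S ∂Measure.pi (fun _ => D)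
            + ENNReal.ofReal δ * M ^ (T.card + 1)
          ≤ c * (c ^ T.card + T.card * (ENNReal.ofReal δ * M ^ T.card))
            + ENNReal.ofReal δ * M ^ (T.card + 1) := by gcongr
        _ = c ^ (T.card + 1) + c * (T.card * (ENNReal.ofReal δ * M ^ T.card))
            + ENNReal.ofReal δ * M ^ (T.card + 1) := by ring
        -- Since c ≤ M, the earlier δ-errors grow by at most M per step and merge with the new one.
        _ ≤ c ^ (T.card + 1) + M * (T.card * (ENNReal.ofReal δ * M ^ T.card))
            + ENNReal.ofReal δ * M ^ (T.card + 1) := by gcongr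
        _ = _ := by push_cast; ring

/-! ### Change of measure and the exponential moment. -/

/-- The Donsker–Varadhan inequality for a bounded function. -/
theorem integral_le_klDiv_add_log {U : Type*} [MeasurableSpace U] {Q P : Measure U}
    [IsProbabilityMeasure Q] [IsProbabilityMeasure P] (hQP : InformationTheory.klDiv Q P ≠ ∞)
    {f : U → ℝ} (hf : Measurable f) {C : ℝ} (hC : ∀ u, |f u| ≤ C) :
    ∫ u, f u ∂Q ≤ (InformationTheory.klDiv Q P).toReal + Real.log (∫ u, Real.exp (f u) ∂P) := by
  obtain ⟨hac, hint⟩ := InformationTheory.klDiv_ne_top_iff.1 hQP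
  have hfQ : Integrable f Q := .of_bound hf.aestronglyMeasurable C (.of_forall hC)
  have hexp : Integrable (fun u => Real.exp (f u)) P :=
    .of_bound hf.exp.aestronglyMeasurable (Real.exp C) (.of_forall fun u => by
      rw [Real.norm_eq_abs, Real.abs_exp]
      exact Real.exp_le_exp.2 ((le_abs_self _).trans (hC u)))
  have := isProbabilityMeasure_tilted hexp
  -- This is nonnegativity of the divergence of Q from P tilted by f.
  have hnonneg := InformationTheory.integral_llr_add_sub_measure_univ_nonneg
    (hac.trans (absolutelyContinuous_tilted hexp))
    (integrable_llr_tilted_right hac hfQ hint hexp)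
  rw [integral_llr_tilted_right hac hfQ hexp hint] at hnonneg
  rw [InformationTheory.toReal_klDiv_of_measure_eq hac (by simp)]
  simp only [probReal_univ] at hnonneg
  linarith

/-- The exponential moment of the gap between the mean and the empirical mean of a `[0, 1]`-valued
loss at the output of a differentially private kernel. -/
theorem IsDP.lintegral_exp_le {Z U : Type*} [MeasurableSpace Z] [MeasurableSpace U] {s : ℕ}
    {A : Kernel (Fin s → Z) U} [IsMarkovKernel A] {ε δ : ℝ} (hA : IsDP A ε δ)
    (hε : ε ≤ 1 / 2) (hδ : 0 ≤ δ) (D : Measure Z) [IsProbabilityMeasure D] {L : U → Z → ℝ}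
    (hL : Measurable fun p : U × Z => L p.1 p.2) (hL01 : ∀ u z, L u z ∈ Set.Icc (0 : ℝ) 1) :
    ∫⁻ S, ∫⁻ u, ENNReal.ofReal (Real.exp (∑ i, 2 * (∫ z, L u z ∂D - L u (S i)))) ∂A S
        ∂Measure.pi (fun _ => D)
      ≤ ENNReal.ofReal (Real.exp (s * (ε + 1 / 2)) + s * (δ * Real.exp (2 * s))) := by
  have hLu (u : U) : Measurable (L u) := hL.comp (by fun_prop : Measurable fun z : Z => (u, z))
  have hmean : Measurable fun u => ∫ z, L u z ∂D :=
    (StronglyMeasurable.integral_prod_right hL.stronglyMeasurable).measurable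
  have hmean1 (u : U) : ∫ z, L u z ∂D ≤ 1 := by
    have hint : Integrable (L u) D :=
      .of_mem_Icc 0 1 (hLu u).aemeasurable (.of_forall (hL01 u))
    simpa using integral_mono hint (integrable_const (1 : ℝ)) fun z => (hL01 u z).2
  have hprod (u : U) (S : Fin s → Z) :
      ENNReal.ofReal (Real.exp (∑ i, 2 * (∫ z, L u z ∂D - L u (S i))))
        = ∏ i, ENNReal.ofReal (Real.exp (2 * (∫ z, L u z ∂D - L u (S i)))) := by
    rw [Real.exp_sum, ENNReal.ofReal_prod_of_nonneg fun _ _ => (Real.exp_pos _).le]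
  have hmgf (u : U) : ∫⁻ z, ENNReal.ofReal (Real.exp (2 * (∫ z, L u z ∂D - L u z))) ∂D
      ≤ ENNReal.ofReal (Real.exp (1 / 2)) := by
    have hsub := hasSubgaussianMGF_of_mem_Icc (hLu u).aemeasurable (.of_forall (hL01 u) : ∀ᵐ z ∂D, _)
    -- Hoeffding's lemma: the variance proxy is 1/4, so t = −2 gives exp(t²/8) = exp(1/2).
    have hle := hsub.mgf_le (-2)
    have hint := hsub.integrable_exp_mul (-2)
    have heq (z : Z) : -2 * (L u z - ∫ z, L u z ∂D) = 2 * (∫ z, L u z ∂D - L u z) := by ring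
    simp only [mgf, heq] at hle hint
    rw [← ofReal_integral_eq_lintegral_ofReal hint (.of_forall fun _ => (Real.exp_pos _).le)]
    refine ENNReal.ofReal_le_ofReal (hle.trans_eq ?_)
    norm_num
  simp_rw [hprod]
  refine (hA.lintegral_prod_le D
    (g := fun u z => ENNReal.ofReal (Real.exp (2 * (∫ z, L u z ∂D - L u z))))
    (((hmean.comp measurable_fst).sub hL).const_mul 2).exp.ennreal_ofReal
    (M := ENNReal.ofReal (Real.exp 2)) ENNReal.ofReal_ne_top (fun u z => ?_)
    (m := ENNReal.ofReal (Real.exp (1 / 2))) ENNReal.ofReal_ne_top hmgf ?_ Finset.univ).trans_eq ?_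
  · refine ENNReal.ofReal_le_ofReal (Real.exp_le_exp.2 ?_)
    linarith [hmean1 u, (hL01 u z).1]
  · rw [← ENNReal.ofReal_mul (Real.exp_pos _).le, ← Real.exp_add]
    exact ENNReal.ofReal_le_ofReal (Real.exp_le_exp.2 (by linarith))
  · rw [← ENNReal.ofReal_mul (Real.exp_pos _).le, ← Real.exp_add,
      ← ENNReal.ofReal_pow (Real.exp_pos _).le, ← ENNReal.ofReal_pow (Real.exp_pos _).le,
      ← Real.exp_nat_mul, ← Real.exp_nat_mul, Finset.card_univ, Fintype.card_fin,
      ← ENNReal.ofReal_mul hδ, ← ENNReal.ofReal_natCast, ← ENNReal.ofReal_mul (by positivity),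
      ← ENNReal.ofReal_add (by positivity) (by positivity), mul_comm (s : ℝ) 2]

/-! ### From the exponential moment to risk bounds. -/

/-- A PAC-Bayes bound from an exponential moment bound under a data-dependent prior. -/
theorem holdsWithProbAtLeast_integral_le {Ω U : Type*} [MeasurableSpace Ω] [MeasurableSpace U]
    (μ : Measure Ω) [IsProbabilityMeasure μ] (P : Kernel Ω U) [IsMarkovKernel P]
    {F : U → Ω → ℝ} (hF : Measurable fun p : U × Ω => F p.1 p.2) {C : ℝ}
    (hC : ∀ u ω, |F u ω| ≤ C) {X Δ : ℝ} (hX : 0 < X) (hΔ : 0 < Δ)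
    (hFX : ∫⁻ ω, ∫⁻ u, ENNReal.ofReal (Real.exp (F u ω)) ∂P ω ∂μ ≤ ENNReal.ofReal X) :
    HoldsWithProbAtLeast μ (1 - Δ) fun ω => ∀ Q : Measure U, IsProbabilityMeasure Q →
      InformationTheory.klDiv Q (P ω) ≠ ⊤ →
        ∫ u, F u ω ∂Q ≤ (InformationTheory.klDiv Q (P ω)).toReal + Real.log (X / Δ) := by
  have hXΔ : 0 < X / Δ := div_pos hX hΔ
  have hmeas : Measurable fun ω => ∫⁻ u, ENNReal.ofReal (Real.exp (F u ω)) ∂P ω :=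
    Measurable.lintegral_kernel_prod_right (f := fun ω u => ENNReal.ofReal (Real.exp (F u ω)))
      (hF.comp measurable_swap).exp.ennreal_ofReal
  -- This event does not involve Q, which makes the bound simultaneous in Q.
  set G : Set Ω := {ω | ∫⁻ u, ENNReal.ofReal (Real.exp (F u ω)) ∂P ω ≤ ENNReal.ofReal (X / Δ)}
  have hG : MeasurableSet G := measurableSet_le hmeas measurable_const
  refine ⟨G, hG, fun ω hω Q _ hQ => ?_, ?_⟩
  · have hFω : Measurable fun u => F u ω := hF.comp (by fun_prop : Measurable fun u : U => (u, ω))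
    have hint : Integrable (fun u => Real.exp (F u ω)) (P ω) :=
      .of_bound hFω.exp.aestronglyMeasurable (Real.exp C) (.of_forall fun u => by
        rw [Real.norm_eq_abs, Real.abs_exp]
        exact Real.exp_le_exp.2 ((le_abs_self _).trans (hC u ω)))
    refine (integral_le_klDiv_add_log hQ hFω (hC · ω)).trans ?_
    gcongr
    · exact integral_exp_pos hint
    · rw [Set.mem_ofPred_eq, ← ofReal_integral_eq_lintegral_ofReal hint
        (.of_forall fun _ => (Real.exp_pos _).le)] at hω
      exact (ENNReal.ofReal_le_ofReal_iff hXΔ.le).1 hω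
  · have hcompl : μ Gᶜ ≤ ENNReal.ofReal Δ := by
      calc μ Gᶜ ≤ μ {ω | ENNReal.ofReal (X / Δ) ≤ ∫⁻ u, ENNReal.ofReal (Real.exp (F u ω)) ∂P ω} :=
            measure_mono fun ω hω => by
              simp only [G, Set.mem_compl_iff, Set.mem_ofPred_eq, not_le] at hω ⊢
              exact hω.le
        _ ≤ (∫⁻ ω, ∫⁻ u, ENNReal.ofReal (Real.exp (F u ω)) ∂P ω ∂μ) / ENNReal.ofReal (X / Δ) :=
            meas_ge_le_lintegral_div hmeas.aemeasurable (by simpa using hXΔ)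
              ENNReal.ofReal_ne_top
        _ ≤ ENNReal.ofReal X / ENNReal.ofReal (X / Δ) := by gcongr
        _ = ENNReal.ofReal Δ := by
            rw [← ENNReal.ofReal_div_of_pos hXΔ, div_div_cancel₀ hX.ne']
    rw [ENNReal.ofReal_sub _ hΔ.le, ENNReal.ofReal_one, tsub_le_iff_right,
      ← prob_add_prob_compl (μ := μ) hG]
    gcongr

/-- A number that is at most one and at most `y / (2 * s)` is at most `√(y / (2 * s - 1))`. -/
theorem le_sqrt_of_two_mul_le {s x y : ℝ} (hs : 1 ≤ s) (hx : x ≤ 1) (hxy : 2 * s * x ≤ y) :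
    x ≤ √(1 / (2 * s - 1) * y) := by
  rcases le_or_gt x 0 with h | h
  · exact h.trans (Real.sqrt_nonneg _)
  · refine Real.le_sqrt_of_sq_le ?_
    rw [one_div, ← div_eq_inv_mul, le_div_iff₀ (by linarith)]
    -- (2s − 1)x² ≤ (2s − 1)x ≤ 2sx ≤ y.
    nlinarith [mul_nonneg h.le (sub_nonneg.2 hx)]

/-- The PAC-Bayes bound for a loss with values in `[a, b]` and a differentially private prior. -/
theorem IsDP.holdsWithProbAtLeast_risk_le {𝒳 𝒴 Θ Λ : Type*} [MeasurableSpace 𝒳]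
    [MeasurableSpace 𝒴] [MeasurableSpace Θ] (D : Measure (𝒳 × 𝒴)) [IsProbabilityMeasure D]
    {a b : ℝ} (hab : a ≤ b) {ℓ : Θ → 𝒳 → 𝒴 → Λ → ℝ} {lam : Λ}
    (hℓ : Measurable fun p : Θ × 𝒳 × 𝒴 => ℓ p.1 p.2.1 p.2.2 lam)
    (hℓab : ∀ θ x y, ℓ θ x y lam ∈ Set.Icc a b) {s : ℕ} (hs : 1 ≤ s) {ε δ : ℝ}
    (hε : ε ≤ 1 / 2) (hδ : 0 ≤ δ) {P : Kernel (Fin s → 𝒳 × 𝒴) Θ} [IsMarkovKernel P]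
    (hP : IsDP P ε δ) {X Δ : ℝ} (hΔ : 0 < Δ)
    (hX : Real.exp (s * (ε + 1 / 2)) + s * (δ * Real.exp (2 * s)) ≤ X) :
    HoldsWithProbAtLeast (Measure.pi fun _ : Fin s => D) (1 - Δ) fun S =>
      ∀ Q : Measure Θ, IsProbabilityMeasure Q → InformationTheory.klDiv Q (P S) ≠ ⊤ →
        ∫ θ, risk ℓ θ D lam ∂Q ≤ ∫ θ, empRisk ℓ θ S lam ∂Q +
          (b - a) * √(1 / (2 * (s : ℝ) - 1) *
            ((InformationTheory.klDiv Q (P S)).toReal + Real.log (X / Δ))) := by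
  have hs1 : (1 : ℝ) ≤ s := by exact_mod_cast hs
  have hs0 : (s : ℝ) ≠ 0 := by positivity
  have hba : 0 ≤ b - a := sub_nonneg.2 hab
  set L : Θ → 𝒳 × 𝒴 → ℝ := fun θ z => (ℓ θ z.1 z.2 lam - a) / (b - a) with hLdef
  have hL : Measurable fun p : Θ × (𝒳 × 𝒴) => L p.1 p.2 := (hℓ.sub_const a).div_const _
  have hL01 (θ : Θ) (z : 𝒳 × 𝒴) : L θ z ∈ Set.Icc (0 : ℝ) 1 :=
    ⟨div_nonneg (sub_nonneg.2 (hℓab θ _ _).1) hba,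
      div_le_one_of_le₀ (sub_le_sub_right (hℓab θ _ _).2 a) hba⟩
  -- For a = b the quotient `L` is 0 by convention and the loss is constantly a.
  have hℓL (θ : Θ) (z : 𝒳 × 𝒴) : ℓ θ z.1 z.2 lam = a + (b - a) * L θ z := by
    rcases hba.eq_or_lt with h | h
    · have := hℓab θ z.1 z.2
      rw [← h, zero_mul, add_zero]
      exact le_antisymm (this.2.trans (by linarith)) this.1
    · rw [hLdef, mul_div_cancel₀ _ h.ne']
      ring
  have hLint (θ : Θ) : Integrable (L θ) D :=
    .of_mem_Icc 0 1 (hL.comp (by fun_prop : Measurable fun z : 𝒳 × 𝒴 => (θ, z))).aemeasurable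
      (.of_forall (hL01 θ))
  have hmean : Measurable fun θ => ∫ z, L θ z ∂D :=
    (StronglyMeasurable.integral_prod_right hL.stronglyMeasurable).measurable
  have hmean0 (θ : Θ) : 0 ≤ ∫ z, L θ z ∂D := integral_nonneg fun z => (hL01 θ z).1
  have hmean1 (θ : Θ) : ∫ z, L θ z ∂D ≤ 1 := by
    simpa using integral_mono (hLint θ) (integrable_const (1 : ℝ)) fun z => (hL01 θ z).2
  have hrisk (θ : Θ) : risk ℓ θ D lam = a + (b - a) * ∫ z, L θ z ∂D := by
    simp only [risk, hℓL]
    rw [integral_add (integrable_const _) ((hLint θ).const_mul _), integral_const_mul]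
    simp
  set F : Θ → (Fin s → 𝒳 × 𝒴) → ℝ := fun θ S => ∑ i, 2 * (∫ z, L θ z ∂D - L θ (S i)) with hFdef
  have hF : Measurable fun p : Θ × (Fin s → 𝒳 × 𝒴) => F p.1 p.2 := by
    refine Finset.measurable_fun_sum _ fun i _ => Measurable.const_mul (Measurable.sub ?_ ?_) 2
    · exact hmean.comp measurable_fst
    · exact hL.comp
        (by fun_prop : Measurable fun p : Θ × (Fin s → 𝒳 × 𝒴) => (p.1, p.2 i))
  have hterm (θ : Θ) (z : 𝒳 × 𝒴) : |2 * (∫ z, L θ z ∂D - L θ z)| ≤ 2 :=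
    abs_le.2 ⟨by linarith [hmean0 θ, (hL01 θ z).2], by linarith [hmean1 θ, (hL01 θ z).1]⟩
  have hFC (θ : Θ) (S : Fin s → 𝒳 × 𝒴) : |F θ S| ≤ 2 * s := by
    refine (Finset.abs_sum_le_sum_abs _ _).trans ((Finset.sum_le_sum fun i _ =>
      hterm θ (S i)).trans_eq ?_)
    simp [mul_comm]
  have hgap (θ : Θ) (S : Fin s → 𝒳 × 𝒴) :
      risk ℓ θ D lam = empRisk ℓ θ S lam + (b - a) / (2 * s) * F θ S := by
    simp only [hrisk, empRisk, hℓL, hFdef, ← Finset.mul_sum, Finset.sum_sub_distrib,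
      Finset.sum_add_distrib, Finset.sum_const, Finset.card_univ, Fintype.card_fin, nsmul_eq_mul]
    field_simp
    ring
  have hXpos : 0 < X := lt_of_lt_of_le (by positivity) hX
  obtain ⟨G, hG, hGF, hGΔ⟩ := holdsWithProbAtLeast_integral_le (Measure.pi fun _ : Fin s => D) P
    hF hFC hXpos hΔ ((hP.lintegral_exp_le hε hδ D hL hL01).trans (ENNReal.ofReal_le_ofReal hX))
  refine ⟨G, hG, fun S hS Q _ hQ => ?_, hGΔ⟩
  have hFQ : Integrable (F · S) Q :=
    .of_bound (hF.comp (by fun_prop : Measurable fun θ : Θ => (θ, S))).aestronglyMeasurable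
      (2 * s) (.of_forall fun θ => hFC θ S)
  have hriskQ : Integrable (fun θ => risk ℓ θ D lam) Q := by
    simp only [hrisk]
    refine (integrable_const a).add (Integrable.const_mul ?_ _)
    exact .of_mem_Icc 0 1 hmean.aemeasurable (.of_forall fun θ => ⟨hmean0 θ, hmean1 θ⟩)
  have hempQ : Integrable (fun θ => empRisk ℓ θ S lam) Q := by
    have : (fun θ => empRisk ℓ θ S lam)
        = fun θ => risk ℓ θ D lam - (b - a) / (2 * s) * F θ S := by
      ext θ
      rw [hgap θ S, add_sub_cancel_right]
    rw [this]
    exact hriskQ.sub (hFQ.const_mul _)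
  have hFle : ∫ θ, F θ S ∂Q ≤ 2 * s := by
    simpa using integral_mono hFQ (integrable_const (2 * (s : ℝ)))
      fun θ => (le_abs_self _).trans (hFC θ S)
  simp_rw [hgap _ S]
  rw [integral_add hempQ (hFQ.const_mul _), integral_const_mul, div_mul_eq_mul_div, mul_div_assoc]
  gcongr
  refine le_sqrt_of_two_mul_le hs1 (div_le_one_of_le₀ hFle (by positivity)) ?_
  rw [mul_div_cancel₀ _ (by positivity)]
  exact hGF S hS Q inferInstance hQ

/-! ### Constants and the two stated bounds. -/

/-- The exponential moment of `IsDP.lintegral_exp_le` is at most `β(ε, δ, s) * exp (2 * s)`. -/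
theorem exp_add_le_betaFn_mul_exp {s : ℕ} {ε δ : ℝ} (hε : 0 < ε ∧ ε ≤ 1 / 2)
    (hδ : 0 < δ ∧ δ < ε) :
    Real.exp (s * (ε + 1 / 2)) + s * (δ * Real.exp (2 * s))
      ≤ betaFn 1 ε δ s * Real.exp (2 * s) := by
  have hs : (0 : ℝ) ≤ s := s.cast_nonneg
  have hδsqrt : δ ≤ √(δ / ε) := by
    refine Real.le_sqrt_of_sq_le ?_
    rw [le_div_iff₀ hε.1]
    nlinarith [mul_pos hδ.1 hε.1]
  -- For 0 < ε ≤ 1/2, ε + 1/2 + ε² ≤ 2.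
  have hexp : Real.exp (s * (ε + 1 / 2)) ≤ Real.exp (-(s : ℝ) * ε ^ 2) * Real.exp (2 * s) := by
    rw [← Real.exp_add, Real.exp_le_exp]
    nlinarith [mul_nonneg hs (sub_nonneg.2 hε.2), mul_nonneg (mul_nonneg hs hε.1.le)
      (sub_nonneg.2 hε.2)]
  have hmul : s * (δ * Real.exp (2 * s)) ≤ s * (√(δ / ε) * Real.exp (2 * s)) := by gcongr
  rw [betaFn]
  linarith

end DPPacBayes

theorem mainTheorem3 :
    -- absolute constants: `c₀` is the one in the `O`-term of `β`
    ∃ c₀ c₁ c₂ : ℝ, 0 < c₀ ∧ 0 < c₁ ∧ 0 < c₂ ∧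
      ∀ (𝒳 𝒴 Θ Λ : Type*) [MeasurableSpace 𝒳] [MeasurableSpace 𝒴]
        [MeasurableSpace Θ] [StandardBorelSpace Θ]
        (D : Measure (𝒳 × 𝒴)) [IsProbabilityMeasure D]
        (a b : ℝ) (_hab : a ≤ b)
        (ℓ : Θ → 𝒳 → 𝒴 → Λ → ℝ) (lam : Λ)
        (_hℓ_meas : Measurable fun p : Θ × 𝒳 × 𝒴 => ℓ p.1 p.2.1 p.2.2 lam)
        (_hℓ_bdd : ∀ θ x y, ℓ θ x y lam ∈ Set.Icc a b)
        (s : ℕ) (_hs : 1 ≤ s)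
        (ε δ : ℝ) (_hε : 0 < ε ∧ ε ≤ 1 / 2) (_hδ : 0 < δ ∧ δ < ε)
        (P : Kernel (Fin s → 𝒳 × 𝒴) Θ) [IsMarkovKernel P]
        (_hP : DPPacBayes.IsDP P ε δ)
        (Δ : ℝ) (_hΔ : 0 < Δ ∧ Δ < 1),
        -- first bound
        (DPPacBayes.betaFn c₀ ε δ s < 1 →
          DPPacBayes.HoldsWithProbAtLeast (Measure.pi fun _ : Fin s => D) (1 - Δ) fun S =>
            ∀ Q : Measure Θ, IsProbabilityMeasure Q → InformationTheory.klDiv Q (P S) ≠ ⊤ →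
              ∫ θ, DPPacBayes.risk ℓ θ D lam ∂Q ≤
                ∫ θ, DPPacBayes.empRisk ℓ θ S lam ∂Q +
                  √((b - a) ^ 2 / (2 * (s : ℝ) - 1) *
                    ((InformationTheory.klDiv Q (P S)).toReal +
                      Real.log ((4 * (s : ℝ) *
                            Real.exp ((s : ℝ) * (c₁ * ε ^ 2 + c₂ * √(δ / ε))) +
                          DPPacBayes.betaFn c₀ ε δ s * Real.exp (2 * (s : ℝ))) / Δ)))) ∧
        -- second bound
        (DPPacBayes.betaFn c₀ ε δ s <
            min 1 ((s : ℝ) * Real.exp ((s : ℝ) * (c₁ * ε ^ 2 + c₂ * √(δ / ε) - 2))) →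
          DPPacBayes.HoldsWithProbAtLeast (Measure.pi fun _ : Fin s => D) (1 - Δ) fun S =>
            ∀ Q : Measure Θ, IsProbabilityMeasure Q → InformationTheory.klDiv Q (P S) ≠ ⊤ →
              ∫ θ, DPPacBayes.risk ℓ θ D lam ∂Q ≤
                ∫ θ, DPPacBayes.empRisk ℓ θ S lam ∂Q +
                  (b - a) *
                    √(1 / (2 * (s : ℝ) - 1) *
                        ((InformationTheory.klDiv Q (P S)).toReal +
                          Real.log (5 * (s : ℝ) / Δ)) +
                      c₁ * ε ^ 2 + c₂ * √(δ / ε))) := by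
  -- c₀ = 1 suffices because δ ≤ √(δ/ε); any positive c₁ and c₂ would serve.
  refine ⟨1, 8, 1, one_pos, by norm_num, one_pos, ?_⟩
  intro 𝒳 𝒴 Θ Λ _ _ _ _ D _ a b hab ℓ lam hℓ hℓab s hs ε δ hε hδ P _ hP Δ hΔ
  have hs1 : (1 : ℝ) ≤ s := by exact_mod_cast hs
  have hmoment := DPPacBayes.exp_add_le_betaFn_mul_exp (s := s) hε hδ
  set κ : ℝ := 8 * ε ^ 2 + 1 * √(δ / ε)
  have hκ0 : 0 ≤ κ := by positivity
  obtain ⟨G, hG, hGle, hGΔ⟩ := hP.holdsWithProbAtLeast_risk_le D hab hℓ hℓab hs hε.2 hδ.1.le hΔ.1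
    (hmoment.trans (le_add_of_nonneg_left (b := 4 * (s : ℝ) * Real.exp (s * κ)) (by positivity)))
  refine ⟨fun _ => ⟨G, hG, fun S hS Q hQ hkl => (hGle S hS Q hQ hkl).trans_eq ?_, hGΔ⟩,
    fun hβ => ⟨G, hG, fun S hS Q hQ hkl => (hGle S hS Q hQ hkl).trans ?_, hGΔ⟩⟩
  · rw [div_eq_mul_one_div ((b - a) ^ 2), mul_assoc ((b - a) ^ 2), Real.sqrt_mul (sq_nonneg _),
      Real.sqrt_sq (sub_nonneg.2 hab)]
  · have hβexp : DPPacBayes.betaFn 1 ε δ s * Real.exp (2 * s) ≤ s * Real.exp (s * κ) := by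
      have hκexp : (s : ℝ) * Real.exp (s * κ)
          = s * Real.exp (s * (κ - 2)) * Real.exp (2 * s) := by
        rw [mul_assoc, ← Real.exp_add]
        ring_nf
      rw [hκexp]
      exact mul_le_mul_of_nonneg_right (hβ.le.trans (min_le_right _ _)) (Real.exp_pos _).le
    have hβ0 : 0 < DPPacBayes.betaFn 1 ε δ s := by
      rw [DPPacBayes.betaFn]
      positivity
    -- The condition on β bounds its term by s exp(sκ), whence 4s + s = 5s.
    have hlog : Real.log ((4 * s * Real.exp (s * κ)
        + DPPacBayes.betaFn 1 ε δ s * Real.exp (2 * s)) / Δ)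
          ≤ Real.log (5 * s / Δ) + s * κ := by
      have hΔ0 := hΔ.1
      have hs5 : 5 * (s : ℝ) / Δ ≠ 0 := by positivity
      rw [← Real.log_exp (s * κ), ← Real.log_mul hs5 (Real.exp_ne_zero _),
        Real.log_exp, div_mul_eq_mul_div]
      gcongr
      linarith
    have hpos : (0 : ℝ) < 2 * s - 1 := by linarith
    -- s ≤ 2s − 1 because s ≥ 1.
    have hsκ : 1 / (2 * (s : ℝ) - 1) * (s * κ) ≤ κ := by
      rw [one_div, inv_mul_le_iff₀ hpos]
      nlinarith
    have hscale := mul_le_mul_of_nonneg_left hlog (one_div_pos.2 hpos).le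
    gcongr
    linarith
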